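/- Let $p \ge 1$ be an integer, let $0 < q < \rho$ be real numbers, and let $\bar C \ge 0$. There is a constant $K = K(p,\rho,q,\bar C) > 0$ such that the following holds for all integers $1 \le k < N$. Let $\mathbf{x} = (x_1,\dots,x_N)$ be a random vector in $\mathbb{R}^N$ with independent coordinates such that $\mathbf{E}\,x_i = \sqrt q$ and $\operatorname{Var} x_i = \rho - q$ for every $i$, and such that the coordinates are sub-Gaussian with $\max_{i \le N} \|x_i\|_{\psi_2} \le \bar C$, where $\|y\|_{\psi_2} := \inf\{t > 0 : \mathbf{E}\exp(y^2/t^2) \le 2\}$. Let $\Theta$ be an $N \times k$ random matrix with independent $\mathcal{N}(0, 1/N)$ entries, independent of $\mathbf{x}$, and let $\boldsymbol{\xi}$ be a standard Gaussian vector in $\mathbb{R}^k$, independent of $(\mathbf{x},\Theta)$. Then $$ \sup_{\|g\|_{\mathrm{Lip}} \le 1,\ \|g\|_\infty \le 1} \mathbf{E}_{\Theta}\left[\left( \mathbf{E}_{\mathbf{x}}\left[g(\Theta^\top \mathbf{x})\right] - \mathbf{E}_{\boldsymbol{\xi}}\left[ g\left(\Theta^\top \mathbf{E}[\mathbf{x}]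 + \sqrt{\rho - q}\,\boldsymbol{\xi}\right)\right]\right)^{2p}\right] \le \frac{K(p,\rho,q,\bar C)\, k}{\sqrt N}, $$ where the supremum is over functions $g : \mathbb{R}^k \to \mathbb{R}$ that are $1$-Lipschitz for the Euclidean norm and bounded by $1$ in absolute value, and $\mathbf{E}_Y$ denotes the expectation with respect to $Y$ only, all other random elements being held fixed. -/

import Mathlib

open MeasureTheory ProbabilityTheory
open scoped NNReal ENNReal

noncomputable section

/-- The sub-Gaussian (`ψ₂`) norm `inf {t > 0 : 𝔼 exp (Y² / t²) ≤ 2}` of a real random variable `Y`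
under `μ`, with value `∞` if there is no such `t` (that is, if `Y` is not sub-Gaussian). -/
def subGaussianNorm {Ω : Type*} [MeasurableSpace Ω] (Y : Ω → ℝ) (μ : Measure Ω) : ℝ≥0∞ :=
  ⨅ (t : ℝ) (_ : 0 < t)
    (_ : ∫⁻ ω, ENNReal.ofReal (Real.exp (Y ω ^ 2 / t ^ 2)) ∂μ ≤ 2), ENNReal.ofReal t

/-- The law of an `N × k` random matrix with i.i.d. centred Gaussian entries of variance `1 / N`,
given as its array of entries. -/
def gaussianProjectionLaw (N k : ℕ) : Measure (Fin N → Fin k → ℝ) :=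
  Measure.pi fun _ : Fin N => Measure.pi fun _ : Fin k => gaussianReal 0 (1 / (N : ℝ≥0))

/-- The projection `Θᵀ v ∈ ℝᵏ` of a vector `v ∈ ℝᴺ`, as an element of Euclidean space. -/
def projectVec {N k : ℕ} (Θ : Fin N → Fin k → ℝ) (v : EuclideanSpace ℝ (Fin N)) :
    EuclideanSpace ℝ (Fin k) :=
  WithLp.toLp 2 (Matrix.mulVec (Matrix.of Θ).transpose (WithLp.ofLp v))

end

/-! Write `A Θ` for the average of `g(Θᵀx)` over `x`, and `B Θ` for the average of `g(Θᵀm + √(ρ-q)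
ξ)` over `ξ`, with `m = 𝔼x`. Since `|A - B| ≤ 2`, the `2p`-th moment is at most `4 ^ p` times the
second moment `𝔼A² - 2𝔼AB + 𝔼B²`, so it suffices that the three correlations share one limit with
error `O(k/√N)`.

Each correlation is computed with replicas: a product of two averages is an average over two
independent copies, and Fubini puts the average over `Θ` inside. For fixed vectors `h, h'`, the pair
`(Θᵀh + rξ, Θᵀh' + r'ξ')` is centred Gaussian with covariance `[[a, c], [c, b]] ⊗ I`, where `a =
‖h‖²/N + r²`, `b = ‖h'‖²/N + r'²`, `c = ⟪h, h'⟫/N` (`map_projectVec_pair_eq_map_choleskyPair`). In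
all three cases `(a, c, b)` is near `(ρ, q, ρ)`: the norms and overlaps of `x` and `x'` concentrate
at scale `1/√N` by second-moment bounds, and the smoothing radius `√(ρ-q)` restores exactly the
variance that `m` lacks, as `‖m‖²/N = q`.

The passage from covariances to correlations is `abs_integral_choleskyPair_sub_le`. Since `q < ρ`
the limiting covariance is nondegenerate, so its Cholesky factors are locally Lipschitz; coupling
the two Gaussian pairs through the same standard vectors then costs a multiple of `𝔼‖ξ‖ ≤ k`.
`abs_correlation_sub_le` combines these facts, and the common limit cancels because `1 - 2 + 1 = 0`.
-/

/-! ### Joint Gaussian law of two projections -/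

open scoped RealInnerProductSpace in
theorem integral_exp_linear_gaussianProjectionLaw (N k : ℕ) (M : Fin N → Fin k → ℝ) :
    ∫ Θ, Complex.exp (((∑ i, ∑ j, M i j * Θ i j : ℝ) : ℂ) * Complex.I)
        ∂(gaussianProjectionLaw N k)
      = Complex.exp (((-((∑ i, ∑ j, M i j ^ 2) / N) / 2 : ℝ) : ℂ)) := by
  have h1 : ∀ Θ : Fin N → Fin k → ℝ,
      Complex.exp (((∑ i, ∑ j, M i j * Θ i j : ℝ) : ℂ) * Complex.I)
        = ∏ i, ∏ j, Complex.exp ((M i j : ℂ) * (Θ i j : ℂ) * Complex.I) := by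
    intro Θ
    simp_rw [← Complex.exp_sum]
    push_cast
    simp_rw [Finset.sum_mul]
  simp_rw [h1]
  unfold gaussianProjectionLaw
  rw [integral_fintype_prod_eq_prod
    (f := fun i (y : Fin k → ℝ) => ∏ j, Complex.exp ((M i j : ℂ) * (y j : ℂ) * Complex.I))]
  have h2 : ∀ i, ∫ y : Fin k → ℝ, ∏ j, Complex.exp ((M i j : ℂ) * (y j : ℂ) * Complex.I)
      ∂(Measure.pi fun _ : Fin k => gaussianReal 0 (1 / (N : ℝ≥0)))
      = ∏ j, Complex.exp (((-((M i j) ^ 2 / N) / 2 : ℝ) : ℂ)) := by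
    intro i
    rw [integral_fintype_prod_eq_prod
      (f := fun j (y : ℝ) => Complex.exp ((M i j : ℂ) * (y : ℂ) * Complex.I))]
    refine Finset.prod_congr rfl fun j _ => ?_
    rw [← charFun_apply_real, charFun_gaussianReal]
    congr 1
    push_cast
    ring
  simp_rw [h2, ← Complex.exp_sum]
  congr 1
  push_cast
  simp_rw [Finset.sum_div, ← Finset.sum_neg_distrib, Finset.sum_div]

theorem projectVec_apply {N k : ℕ} (Θ : Fin N → Fin k → ℝ) (v : EuclideanSpace ℝ (Fin N))
    (j : Fin k) : projectVec Θ v j = ∑ i, Θ i j * v i := by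
  simp [projectVec, Matrix.mulVec, dotProduct]

theorem measurable_projectVec_uncurry {N k : ℕ} :
    Measurable (fun z : (Fin N → Fin k → ℝ) × EuclideanSpace ℝ (Fin N) => projectVec z.1 z.2) := by
  have : (fun z : (Fin N → Fin k → ℝ) × EuclideanSpace ℝ (Fin N) => projectVec z.1 z.2)
      = fun z => WithLp.toLp 2 (fun j => ∑ i, z.1 i j * z.2 i) := by
    ext z j
    simp [projectVec_apply]
  rw [this]
  fun_prop

theorem Measurable.projectVec {α : Type*} [MeasurableSpace α] {N k : ℕ}
    {f : α → Fin N → Fin k → ℝ} {v : α → EuclideanSpace ℝ (Fin N)}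
    (hf : Measurable f) (hv : Measurable v) :
    Measurable fun a => _root_.projectVec (f a) (v a) :=
  measurable_projectVec_uncurry.comp (hf.prodMk hv)

instance isProbabilityMeasure_gaussianProjectionLaw (N k : ℕ) :
    IsProbabilityMeasure (gaussianProjectionLaw N k) := by
  unfold gaussianProjectionLaw
  infer_instance

open scoped RealInnerProductSpace in
theorem integral_exp_inner_projectVec {N k : ℕ} (h h' : EuclideanSpace ℝ (Fin N))
    (s t : EuclideanSpace ℝ (Fin k)) :
    ∫ Θ, Complex.exp (((⟪projectVec Θ h, s⟫ + ⟪projectVec Θ h', t⟫ : ℝ) : ℂ) * Complex.I)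
        ∂(gaussianProjectionLaw N k)
      = Complex.exp (((-((‖h‖ ^ 2 / N) * ‖s‖ ^ 2 + 2 * (⟪h, h'⟫ / N) * ⟪s, t⟫
          + (‖h'‖ ^ 2 / N) * ‖t‖ ^ 2) / 2 : ℝ) : ℂ)) := by
  have key := integral_exp_linear_gaussianProjectionLaw N k (fun i j => h i * s j + h' i * t j)
  have e1 : ∀ Θ : Fin N → Fin k → ℝ, ∑ i, ∑ j, (h i * s j + h' i * t j) * Θ i j
      = ⟪projectVec Θ h, s⟫ + ⟪projectVec Θ h', t⟫ := by
    intro Θ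
    rw [Finset.sum_comm]
    simp only [PiLp.inner_apply, projectVec_apply, RCLike.inner_apply, conj_trivial,
      Finset.mul_sum, ← Finset.sum_add_distrib]
    refine Finset.sum_congr rfl fun j _ => Finset.sum_congr rfl fun i _ => by ring
  have e2 : ∑ i, ∑ j, (h i * s j + h' i * t j) ^ 2
      = ‖h‖ ^ 2 * ‖s‖ ^ 2 + 2 * ⟪h, h'⟫ * ⟪s, t⟫ + ‖h'‖ ^ 2 * ‖t‖ ^ 2 := by
    simp only [EuclideanSpace.real_norm_sq_eq, PiLp.inner_apply, RCLike.inner_apply, conj_trivial,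
      mul_assoc, Finset.sum_mul_sum]
    simp only [Finset.mul_sum, ← Finset.sum_add_distrib]
    refine Finset.sum_congr rfl fun j _ => Finset.sum_congr rfl fun i _ => by ring
  simp_rw [e1] at key
  rw [key, e2]
  congr 2
  ring

/-- The pair `(√a z₁, u z₁ + √(b - u²) z₂)` with `u = c / √a`. When `z₁, z₂` are independent
standard Gaussian vectors it is Gaussian with covariance `[[a, c], [c, b]] ⊗ I`. -/
noncomputable def choleskyPair {E : Type*} [AddCommGroup E] [Module ℝ E] (a c b : ℝ) (z : E × E) :
    E × E :=
  (√a • z.1, (c / √a) • z.1 + √(b - (c / √a) ^ 2) • z.2)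

theorem div_sqrt_sq_le {a b c : ℝ} (ha : 0 ≤ a) (hb : 0 ≤ b) (hc : c ^ 2 ≤ a * b) :
    (c / √a) ^ 2 ≤ b := by
  rw [div_pow, Real.sq_sqrt ha]
  rcases ha.eq_or_lt with rfl | ha
  · simpa using hb
  · rw [div_le_iff₀ ha]; linarith

/-- When `a = 0` the constraint `c² ≤ ab` forces `c = 0`, so the convention `c / 0 = 0` is harmless
and `choleskyPair` has the right covariance in the degenerate case too. -/
theorem sqrt_mul_div_sqrt {a b c : ℝ} (ha : 0 ≤ a) (hc : c ^ 2 ≤ a * b) :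
    √a * (c / √a) = c := by
  rcases ha.eq_or_lt with rfl | ha
  · have : c = 0 := by nlinarith
    simp [this]
  · have := Real.sqrt_pos.2 ha
    field_simp

open scoped RealInnerProductSpace in
theorem integral_exp_inner_stdGaussian {E : Type*} [NormedAddCommGroup E] [InnerProductSpace ℝ E]
    [FiniteDimensional ℝ E] [MeasurableSpace E] [BorelSpace E] (t : E) :
    ∫ z, Complex.exp (((⟪z, t⟫ : ℝ) : ℂ) * Complex.I) ∂(stdGaussian E)
      = Complex.exp (((-(‖t‖ ^ 2) / 2 : ℝ) : ℂ)) := by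
  rw [← charFun_apply, charFun_stdGaussian]
  push_cast
  rfl

open scoped RealInnerProductSpace in
theorem integral_exp_inner_choleskyPair {E : Type*} [NormedAddCommGroup E]
    [InnerProductSpace ℝ E] [FiniteDimensional ℝ E] [MeasurableSpace E] [BorelSpace E]
    {a b c : ℝ} (ha : 0 ≤ a) (hb : 0 ≤ b) (hc : c ^ 2 ≤ a * b) (s t : E) :
    ∫ z, Complex.exp (((⟪(choleskyPair a c b z).1, s⟫ + ⟪(choleskyPair a c b z).2, t⟫ : ℝ) : ℂ)
        * Complex.I) ∂((stdGaussian E).prod (stdGaussian E))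
      = Complex.exp (((-(a * ‖s‖ ^ 2 + 2 * c * ⟪s, t⟫ + b * ‖t‖ ^ 2) / 2 : ℝ) : ℂ)) := by
  set u := c / √a with hu
  set β := √(b - u ^ 2) with hβ
  have hβ2 : β ^ 2 = b - u ^ 2 := Real.sq_sqrt (by linarith [div_sqrt_sq_le ha hb hc])
  have hau : √a * u = c := sqrt_mul_div_sqrt ha hc
  have ha2 : √a ^ 2 = a := Real.sq_sqrt ha
  have e : ∀ z : E × E,
      Complex.exp (((⟪(choleskyPair a c b z).1, s⟫ + ⟪(choleskyPair a c b z).2, t⟫ : ℝ) : ℂ)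
        * Complex.I)
      = Complex.exp (((⟪z.1, √a • s + u • t⟫ : ℝ) : ℂ) * Complex.I)
        * Complex.exp (((⟪z.2, β • t⟫ : ℝ) : ℂ) * Complex.I) := by
    intro z
    rw [← Complex.exp_add]
    congr 1
    simp only [choleskyPair, inner_add_left, inner_add_right, inner_smul_left, inner_smul_right,
      conj_trivial, ← hu, ← hβ]
    push_cast
    ring
  simp_rw [e]
  rw [integral_prod_mul (f := fun z : E => Complex.exp (((⟪z, √a • s + u • t⟫ : ℝ) : ℂ) * Complex.I))
    (g := fun z : E => Complex.exp (((⟪z, β • t⟫ : ℝ) : ℂ) * Complex.I)),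
    integral_exp_inner_stdGaussian, integral_exp_inner_stdGaussian, ← Complex.exp_add,
    ← Complex.ofReal_add]
  congr 2
  rw [@norm_add_sq_real, norm_smul, norm_smul, norm_smul, inner_smul_left, inner_smul_right,
    mul_pow, mul_pow, mul_pow]
  simp only [Real.norm_eq_abs, sq_abs, conj_trivial]
  rw [ha2, hβ2, ← hau]
  ring

open scoped RealInnerProductSpace in
theorem sq_inner_div_le {N : ℕ} (h h' : EuclideanSpace ℝ (Fin N)) (r r' : ℝ) :
    (⟪h, h'⟫ / N) ^ 2 ≤ (‖h‖ ^ 2 / N + r ^ 2) * (‖h'‖ ^ 2 / N + r' ^ 2) := by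
  have h1 : (⟪h, h'⟫ / N) ^ 2 ≤ (‖h‖ ^ 2 / N) * (‖h'‖ ^ 2 / N) := by
    rw [div_pow, div_mul_div_comm, ← sq (N : ℝ), ← mul_pow]
    refine div_le_div_of_nonneg_right ?_ (sq_nonneg _)
    exact sq_le_sq' (neg_le_of_abs_le (abs_real_inner_le_norm h h')) (real_inner_le_norm h h')
  refine h1.trans ?_
  gcongr <;> nlinarith [sq_nonneg r, sq_nonneg r']

open scoped RealInnerProductSpace in
/-- A pair of Gaussian fields driven by the same random projection has the law of a
`choleskyPair` of independent standard Gaussian vectors. -/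
theorem map_projectVec_pair_eq_map_choleskyPair {N k : ℕ} (h h' : EuclideanSpace ℝ (Fin N))
    (r r' : ℝ) :
    ((gaussianProjectionLaw N k).prod ((stdGaussian (EuclideanSpace ℝ (Fin k))).prod
        (stdGaussian (EuclideanSpace ℝ (Fin k))))).map
      (fun w => (projectVec w.1 h + r • w.2.1, projectVec w.1 h' + r' • w.2.2))
    = ((stdGaussian (EuclideanSpace ℝ (Fin k))).prod (stdGaussian (EuclideanSpace ℝ (Fin k)))).map
      (choleskyPair (‖h‖ ^ 2 / N + r ^ 2) (⟪h, h'⟫ / N) (‖h'‖ ^ 2 / N + r' ^ 2)) := by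
  have hm1 : Measurable (fun w : (Fin N → Fin k → ℝ) × EuclideanSpace ℝ (Fin k) ×
      EuclideanSpace ℝ (Fin k) =>
      (projectVec w.1 h + r • w.2.1, projectVec w.1 h' + r' • w.2.2)) := by
    have := (measurable_fst (α := Fin N → Fin k → ℝ) (β := EuclideanSpace ℝ (Fin k) ×
      EuclideanSpace ℝ (Fin k))).projectVec (measurable_const (a := h))
    have := (measurable_fst (α := Fin N → Fin k → ℝ) (β := EuclideanSpace ℝ (Fin k) ×
      EuclideanSpace ℝ (Fin k))).projectVec (measurable_const (a := h'))
    fun_prop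
  have hm2 : Measurable (choleskyPair (E := EuclideanSpace ℝ (Fin k))
      (‖h‖ ^ 2 / N + r ^ 2) (⟪h, h'⟫ / N) (‖h'‖ ^ 2 / N + r' ^ 2)) := by
    unfold choleskyPair; fun_prop
  have ha : 0 ≤ ‖h‖ ^ 2 / N + r ^ 2 := by positivity
  have hb : 0 ≤ ‖h'‖ ^ 2 / N + r' ^ 2 := by positivity
  have hc := sq_inner_div_le h h' r r'
  -- Characteristic functions need an inner product, which the sup-normed product does not carry;
  -- both laws are transported to the `L²` product.
  refine (MeasurableEquiv.toLp 2 (EuclideanSpace ℝ (Fin k) ×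
    EuclideanSpace ℝ (Fin k))).map_measurableEquiv_injective ?_
  have := Measure.isProbabilityMeasure_map (μ := (gaussianProjectionLaw N k).prod
    ((stdGaussian (EuclideanSpace ℝ (Fin k))).prod
        (stdGaussian (EuclideanSpace ℝ (Fin k))))) hm1.aemeasurable
  have := Measure.isProbabilityMeasure_map (μ := ((stdGaussian (EuclideanSpace ℝ (Fin k))).prod
        (stdGaussian (EuclideanSpace ℝ (Fin k))))) hm2.aemeasurable
  refine Measure.ext_of_charFun <| funext fun st ↦ ?_
  rw [charFun_apply, charFun_apply, integral_map_equiv, integral_map_equiv,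
    integral_map hm1.aemeasurable (Measurable.aestronglyMeasurable (by fun_prop)),
    integral_map hm2.aemeasurable (Measurable.aestronglyMeasurable (by fun_prop))]
  simp only [MeasurableEquiv.coe_toLp, WithLp.prod_inner_apply]
  rw [integral_exp_inner_choleskyPair ha hb hc]
  set s := st.ofLp.1
  set t := st.ofLp.2
  have e : ∀ w : (Fin N → Fin k → ℝ) × EuclideanSpace ℝ (Fin k) × EuclideanSpace ℝ (Fin k),
      Complex.exp (((⟪projectVec w.1 h + r • w.2.1, s⟫ +
        ⟪projectVec w.1 h' + r' • w.2.2, t⟫ : ℝ) : ℂ) * Complex.I)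
      = Complex.exp (((⟪projectVec w.1 h, s⟫ + ⟪projectVec w.1 h', t⟫ : ℝ) : ℂ) * Complex.I) *
        (Complex.exp (((⟪w.2.1, r • s⟫ : ℝ) : ℂ) * Complex.I)
        * Complex.exp (((⟪w.2.2, r' • t⟫ : ℝ) : ℂ) * Complex.I)) := by
    intro w
    rw [← Complex.exp_add, ← Complex.exp_add]
    congr 1
    simp only [inner_add_left, inner_smul_left, inner_smul_right, conj_trivial]
    push_cast
    ring
  refine (integral_congr_ae (Filter.Eventually.of_forall e)).trans ?_
  rw [integral_prod_mul (f := fun Θ => Complex.exp (((⟪projectVec Θ h, s⟫ +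
      ⟪projectVec Θ h', t⟫ : ℝ) : ℂ) * Complex.I))
    (g := fun w : EuclideanSpace ℝ (Fin k) × EuclideanSpace ℝ (Fin k) =>
      Complex.exp (((⟪w.1, r • s⟫ : ℝ) : ℂ) * Complex.I)
        * Complex.exp (((⟪w.2, r' • t⟫ : ℝ) : ℂ) * Complex.I)),
    integral_prod_mul (f := fun w : EuclideanSpace ℝ (Fin k) =>
      Complex.exp (((⟪w, r • s⟫ : ℝ) : ℂ) * Complex.I))
      (g := fun w : EuclideanSpace ℝ (Fin k) =>
      Complex.exp (((⟪w, r' • t⟫ : ℝ) : ℂ) * Complex.I)),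
    integral_exp_inner_projectVec, integral_exp_inner_stdGaussian, integral_exp_inner_stdGaussian,
    ← Complex.exp_add, ← Complex.exp_add, ← Complex.ofReal_add, ← Complex.ofReal_add]
  congr 2
  rw [norm_smul, norm_smul, mul_pow, mul_pow]
  simp only [Real.norm_eq_abs, sq_abs]
  ring

/-! ### Stability of Gaussian correlations in the covariance -/

theorem abs_sqrt_sub_sqrt_le {x y : ℝ} (hx : 0 ≤ x) (hy : 0 < y) :
    |√x - √y| ≤ |x - y| / √y := by
  have hy' := Real.sqrt_pos.2 hy
  have hx' := Real.sqrt_nonneg x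
  rw [le_div_iff₀ hy']
  have : x - y = (√x - √y) * (√x + √y) := by
    nlinarith [Real.sq_sqrt hx, Real.sq_sqrt hy.le]
  rw [this, abs_mul]
  gcongr
  rw [abs_of_nonneg (by positivity)]
  linarith

theorem abs_mul_sub_mul_le {a b c d : ℝ} (hb : |b| ≤ 1) (hc : |c| ≤ 1) :
    |a * b - c * d| ≤ |a - c| + |b - d| := by
  have : a * b - c * d = (a - c) * b + c * (b - d) := by ring
  rw [this]
  refine (abs_add_le _ _).trans ?_
  rw [abs_mul, abs_mul]
  gcongr
  · exact mul_le_of_le_one_right (abs_nonneg _) hb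
  · exact mul_le_of_le_one_left (abs_nonneg _) hc

theorem LipschitzWith.abs_sub_le_norm {E : Type*} [SeminormedAddCommGroup E] {g : E → ℝ}
    (hg : LipschitzWith 1 g) (x y : E) : |g x - g y| ≤ ‖x - y‖ := by
  simpa [Real.dist_eq, dist_eq_norm] using hg.dist_le_mul x y

theorem integral_sq_eval_stdGaussian {k : ℕ} (j : Fin k) :
    ∫ z, (z j) ^ 2 ∂(stdGaussian (EuclideanSpace ℝ (Fin k))) = 1 := by
  rw [← map_pi_eq_stdGaussian, integral_map (by fun_prop)
    (Measurable.aestronglyMeasurable (by fun_prop))]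
  simp only
  rw [integral_comp_eval (μ := fun _ : Fin k => gaussianReal 0 1) (i := j) (f := fun x => x ^ 2)
    (Measurable.aestronglyMeasurable (by fun_prop))]
  have h := variance_id_gaussianReal (μ := 0) (v := 1)
  rw [variance_eq_integral (by fun_prop)] at h
  simpa using h

theorem integrable_norm_stdGaussian {E : Type*} [NormedAddCommGroup E] [InnerProductSpace ℝ E]
    [FiniteDimensional ℝ E] [MeasurableSpace E] [BorelSpace E] :
    Integrable (fun z : E => ‖z‖) (stdGaussian E) :=
  (IsGaussian.integrable_id (μ := stdGaussian E)).norm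

/-- The Euclidean norm is at most the `ℓ¹` norm, and `|t| ≤ (1 + t²)/2` in each coordinate. This
crude bound is the source of the factor `k` in the final estimate. -/
theorem integral_norm_stdGaussian_le {k : ℕ} :
    ∫ z, ‖z‖ ∂(stdGaussian (EuclideanSpace ℝ (Fin k))) ≤ k := by
  have hint : ∀ j : Fin k, Integrable (fun z : EuclideanSpace ℝ (Fin k) => (z j) ^ 2)
      (stdGaussian (EuclideanSpace ℝ (Fin k))) := fun j =>
    Integrable.of_integral_ne_zero (by rw [integral_sq_eval_stdGaussian]; exact one_ne_zero)
  have hint' : ∀ j : Fin k, Integrable (fun z : EuclideanSpace ℝ (Fin k) => (1 + (z j) ^ 2) / 2)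
      (stdGaussian (EuclideanSpace ℝ (Fin k))) := fun j =>
    ((integrable_const _).add (hint j)).div_const 2
  calc ∫ z, ‖z‖ ∂(stdGaussian (EuclideanSpace ℝ (Fin k)))
      ≤ ∫ z, ∑ j, (1 + (z j) ^ 2) / 2 ∂(stdGaussian (EuclideanSpace ℝ (Fin k))) := by
        refine integral_mono integrable_norm_stdGaussian (integrable_finsetSum _ fun j _ => hint' j) fun z => ?_
        have h1 : ‖z‖ ≤ ∑ j, |z j| := by
          rw [EuclideanSpace.norm_eq]
          refine Real.sqrt_le_iff.2 ⟨Finset.sum_nonneg fun _ _ => abs_nonneg _, ?_⟩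
          simpa [sq_abs] using Finset.sum_sq_le_sq_sum_of_nonneg
            (s := Finset.univ) (f := fun j => |z j|) (fun _ _ => abs_nonneg _)
        refine h1.trans (Finset.sum_le_sum fun j _ => ?_)
        nlinarith [sq_nonneg (|z j| - 1), sq_abs (z j)]
    _ = k := by
        rw [integral_finsetSum _ fun j _ => hint' j]
        have : ∀ j : Fin k, ∫ z : EuclideanSpace ℝ (Fin k), (1 + (z j) ^ 2) / 2
            ∂(stdGaussian (EuclideanSpace ℝ (Fin k))) = 1 := by
          intro j
          rw [integral_div, integral_add (integrable_const _) (hint j),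
            integral_sq_eval_stdGaussian]
          simp
        simp [this]

/-- The Cholesky factors depend in a Lipschitz way on the covariance near `[[ρ, q], [q, ρ]]`. -/
theorem cholesky_lipschitz {q ρ : ℝ} (hq : 0 < q) (hqρ : q < ρ) :
    ∃ K : ℝ, 0 < K ∧ ∀ a b c : ℝ, 0 ≤ a → 0 ≤ b → c ^ 2 ≤ a * b →
      |a - ρ| + |b - ρ| + |c - q| ≤ ρ →
      |√a - √ρ| ≤ K * (|a - ρ| + |b - ρ| + |c - q|) ∧
      |c / √a - q / √ρ| ≤ K * (|a - ρ| + |b - ρ| + |c - q|) ∧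
      |√(b - (c / √a) ^ 2) - √(ρ - (q / √ρ) ^ 2)| ≤ K * (|a - ρ| + |b - ρ| + |c - q|) := by
  have hρ : 0 < ρ := hq.trans hqρ
  have hr : 0 < √ρ := Real.sqrt_pos.2 hρ
  have hr2 : √ρ ^ 2 = ρ := Real.sq_sqrt hρ.le
  -- Nondegeneracy of the limit: `ρ - q²/ρ > 0`, which is where `q < ρ` enters. It keeps the last
  -- square root away from its singularity at zero.
  have hδ : 0 < ρ - (q / √ρ) ^ 2 := by
    rw [div_pow, hr2, sub_pos, div_lt_iff₀ hρ]
    nlinarith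
  have hsδ := Real.sqrt_pos.2 hδ
  refine ⟨1 / √ρ + 3 / √ρ + 10 / √(ρ - (q / √ρ) ^ 2), by positivity, ?_⟩
  intro a b c ha hb hc he
  set e := |a - ρ| + |b - ρ| + |c - q| with hedef
  have h1 := abs_nonneg (a - ρ)
  have h2 := abs_nonneg (b - ρ)
  have h3 := abs_nonneg (c - q)
  have he0 : 0 ≤ e := by positivity
  have hu2 := div_sqrt_sq_le ha hb hc
  have hau : √a * (c / √a) = c := sqrt_mul_div_sqrt ha hc
  set u := c / √a
  set u₀ := q / √ρ with hu₀
  have hau₀ : √ρ * u₀ = q := by rw [hu₀]; field_simp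
  have hb2 : b ≤ 2 * ρ := by have := le_abs_self (b - ρ); linarith
  have hu : |u| ≤ 2 * √ρ := by
    refine abs_le_of_sq_le_sq ?_ (by positivity)
    rw [mul_pow, hr2]; linarith
  have hu₀r : |u₀| ≤ √ρ := by
    refine abs_le_of_sq_le_sq ?_ hr.le
    linarith
  have hA : |√a - √ρ| ≤ e / √ρ := by
    refine (abs_sqrt_sub_sqrt_le ha hρ).trans ?_
    gcongr; linarith
  have hB : |u - u₀| ≤ 3 * e / √ρ := by
    rw [le_div_iff₀ hr]
    -- Clearing denominators through `√a u = c` and `√ρ u₀ = q` avoids any lower bound on `a`.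
    have : (u - u₀) * √ρ = (c - q) - u * (√a - √ρ) := by linarith
    calc |u - u₀| * √ρ = |(c - q) - u * (√a - √ρ)| := by
          rw [← this, abs_mul, abs_of_pos hr]
      _ ≤ |c - q| + |u| * |√a - √ρ| := by
          rw [← abs_mul]; exact abs_sub _ _
      _ ≤ e + 2 * √ρ * (e / √ρ) := by gcongr; linarith
      _ = 3 * e := by field_simp; ring
  have hC : |√(b - u ^ 2) - √(ρ - u₀ ^ 2)| ≤ 10 * e / √(ρ - u₀ ^ 2) := by
    refine (abs_sqrt_sub_sqrt_le (by linarith) hδ).trans ?_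
    gcongr
    have : b - u ^ 2 - (ρ - u₀ ^ 2) = (b - ρ) - (u - u₀) * (u + u₀) := by ring
    rw [this]
    calc |(b - ρ) - (u - u₀) * (u + u₀)| ≤ |b - ρ| + |u - u₀| * |u + u₀| := by
          rw [← abs_mul]; exact abs_sub _ _
      _ ≤ e + 3 * e / √ρ * (2 * √ρ + √ρ) := by
          gcongr
          · linarith
          · exact (abs_add_le _ _).trans (add_le_add hu hu₀r)
      _ = 10 * e := by field_simp; ring
  have p1 : 0 ≤ e / √ρ := by positivity
  have p2 : 0 ≤ 3 * e / √ρ := by positivity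
  have p3 : 0 ≤ 10 * e / √(ρ - u₀ ^ 2) := by positivity
  have hK : (1 / √ρ + 3 / √ρ + 10 / √(ρ - u₀ ^ 2)) * e
      = e / √ρ + 3 * e / √ρ + 10 * e / √(ρ - u₀ ^ 2) := by ring
  rw [hK]
  exact ⟨by linarith, by linarith, by linarith⟩

theorem measurable_choleskyPair {k : ℕ} (a c b : ℝ) :
    Measurable (choleskyPair (E := EuclideanSpace ℝ (Fin k)) a c b) := by
  unfold choleskyPair; fun_prop

theorem integrable_of_abs_le_one {α : Type*} [MeasurableSpace α] {μ : Measure α}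
    [IsFiniteMeasure μ] {f : α → ℝ} (hf : Measurable f) (h : ∀ x, |f x| ≤ 1) : Integrable f μ :=
  Integrable.of_bound hf.aestronglyMeasurable 1 (Filter.Eventually.of_forall h)

theorem abs_integral_le_one {α : Type*} [MeasurableSpace α] {μ : Measure α}
    [IsProbabilityMeasure μ] {f : α → ℝ} (h : ∀ x, |f x| ≤ 1) : |∫ x, f x ∂μ| ≤ 1 := by
  simpa using norm_integral_le_of_norm_le_const (μ := μ) (f := f) (C := 1)
    (Filter.Eventually.of_forall h)

theorem abs_mul_le_one_of_abs_le_one {a b : ℝ} (ha : |a| ≤ 1) (hb : |b| ≤ 1) : |a * b| ≤ 1 := by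
  rw [abs_mul]; exact mul_le_one₀ ha (abs_nonneg _) hb

/-- The same `z` feeds both Cholesky pairs, so the difference is bounded pointwise by the
differences of the factors times `‖z.1‖` and `‖z.2‖`. The summand `3 * K` serves covariances near
the limit and `2 / ρ` the others. -/
theorem abs_integral_choleskyPair_sub_le {q ρ : ℝ} (hq : 0 < q) (hqρ : q < ρ) :
    ∃ K : ℝ, 0 < K ∧ ∀ (k : ℕ), 1 ≤ k → ∀ g : EuclideanSpace ℝ (Fin k) → ℝ,
      LipschitzWith 1 g → (∀ y, |g y| ≤ 1) →
      ∀ a b c : ℝ, 0 ≤ a → 0 ≤ b → c ^ 2 ≤ a * b →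
      |(∫ z, g (choleskyPair a c b z).1 * g (choleskyPair a c b z).2
          ∂((stdGaussian (EuclideanSpace ℝ (Fin k))).prod
            (stdGaussian (EuclideanSpace ℝ (Fin k)))))
        - ∫ z, g (choleskyPair ρ q ρ z).1 * g (choleskyPair ρ q ρ z).2
          ∂((stdGaussian (EuclideanSpace ℝ (Fin k))).prod
            (stdGaussian (EuclideanSpace ℝ (Fin k))))|
      ≤ K * k * (|a - ρ| + |b - ρ| + |c - q|) := by
  have hρ : 0 < ρ := hq.trans hqρ
  obtain ⟨K, hK, hKL⟩ := cholesky_lipschitz hq hqρ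
  refine ⟨3 * K + 2 / ρ, by positivity, ?_⟩
  intro k hk g hgL hg1 a b c ha hb hc
  set γ := (stdGaussian (EuclideanSpace ℝ (Fin k)))
  set e := |a - ρ| + |b - ρ| + |c - q| with hedef
  have he0 : 0 ≤ e := by positivity
  have hk1 : (1 : ℝ) ≤ k := by exact_mod_cast hk
  have hgm : Measurable g := hgL.continuous.measurable
  have hm : ∀ a c b : ℝ, Measurable fun z : EuclideanSpace ℝ (Fin k) × EuclideanSpace ℝ (Fin k) =>
      g (choleskyPair a c b z).1 * g (choleskyPair a c b z).2 := fun a c b =>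
    (hgm.comp (measurable_choleskyPair a c b).fst).mul
      (hgm.comp (measurable_choleskyPair a c b).snd)
  have hb1 : ∀ a c b : ℝ, ∀ z : EuclideanSpace ℝ (Fin k) × EuclideanSpace ℝ (Fin k),
      |g (choleskyPair a c b z).1 * g (choleskyPair a c b z).2| ≤ 1 := fun a c b z =>
    abs_mul_le_one_of_abs_le_one (hg1 _) (hg1 _)
  -- Far from the limit the trivial bound `2` on the difference suffices, because `e > ρ` and `k ≥
  -- 1`.
  rcases lt_or_ge ρ e with he | he
  · have i1 := abs_integral_le_one (μ := γ.prod γ) (hb1 a c b)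
    have i2 := abs_integral_le_one (μ := γ.prod γ) (hb1 ρ q ρ)
    refine (abs_sub _ _).trans ((add_le_add i1 i2).trans ?_)
    have : 2 ≤ 2 / ρ * 1 * e := by
      rw [mul_one, div_mul_eq_mul_div, le_div_iff₀ hρ]; linarith
    have h3 : 2 / ρ * 1 * e ≤ 2 / ρ * k * e := by gcongr
    have h4 : 0 ≤ 3 * K * k * e := by positivity
    linarith
  · obtain ⟨hA, hB, hC⟩ := hKL a b c ha hb hc he
    rw [← integral_sub (integrable_of_abs_le_one (hm _ _ _) (hb1 _ _ _))
      (integrable_of_abs_le_one (hm _ _ _) (hb1 _ _ _))]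
    refine abs_integral_le_integral_abs.trans ?_
    have hI1 : Integrable (fun z : EuclideanSpace ℝ (Fin k) × EuclideanSpace ℝ (Fin k) => ‖z.1‖)
        (γ.prod γ) := integrable_norm_stdGaussian.comp_fst γ
    have hI2 : Integrable (fun z : EuclideanSpace ℝ (Fin k) × EuclideanSpace ℝ (Fin k) => ‖z.2‖)
        (γ.prod γ) := integrable_norm_stdGaussian.comp_snd γ
    have e1 : ∫ z : EuclideanSpace ℝ (Fin k) × EuclideanSpace ℝ (Fin k), ‖z.1‖ ∂(γ.prod γ)
        ≤ k := by
      rw [integral_fun_fst (μ := γ) (ν := γ) (fun z => ‖z‖)]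
      simpa using integral_norm_stdGaussian_le
    have e2 : ∫ z : EuclideanSpace ℝ (Fin k) × EuclideanSpace ℝ (Fin k), ‖z.2‖ ∂(γ.prod γ)
        ≤ k := by
      rw [integral_fun_snd (μ := γ) (ν := γ) (fun z => ‖z‖)]
      simpa using integral_norm_stdGaussian_le
    have hpt : ∀ z : EuclideanSpace ℝ (Fin k) × EuclideanSpace ℝ (Fin k),
        |g (choleskyPair a c b z).1 * g (choleskyPair a c b z).2
          - g (choleskyPair ρ q ρ z).1 * g (choleskyPair ρ q ρ z).2|
        ≤ 2 * (K * e) * ‖z.1‖ + K * e * ‖z.2‖ := by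
      intro z
      refine (abs_mul_sub_mul_le (hg1 _) (hg1 _)).trans ?_
      refine (add_le_add (hgL.abs_sub_le_norm _ _) (hgL.abs_sub_le_norm _ _)).trans ?_
      have n1 : ‖(choleskyPair a c b z).1 - (choleskyPair ρ q ρ z).1‖ ≤ K * e * ‖z.1‖ := by
        simp only [choleskyPair, ← sub_smul, norm_smul, Real.norm_eq_abs]
        gcongr
      have n2 : ‖(choleskyPair a c b z).2 - (choleskyPair ρ q ρ z).2‖
          ≤ K * e * ‖z.1‖ + K * e * ‖z.2‖ := by
        simp only [choleskyPair]
        rw [add_sub_add_comm, ← sub_smul, ← sub_smul]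
        refine (norm_add_le _ _).trans ?_
        rw [norm_smul, norm_smul, Real.norm_eq_abs, Real.norm_eq_abs]
        gcongr
      linarith
    refine (integral_mono ((integrable_of_abs_le_one (hm _ _ _) (hb1 _ _ _)).sub
      (integrable_of_abs_le_one (hm _ _ _) (hb1 _ _ _))).abs
      ((hI1.const_mul _).add (hI2.const_mul _)) hpt).trans ?_
    rw [integral_add' (hI1.const_mul _) (hI2.const_mul _), integral_const_mul, integral_const_mul]
    have h5 : 2 * (K * e) * (∫ z : EuclideanSpace ℝ (Fin k) × EuclideanSpace ℝ (Fin k), ‖z.1‖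
        ∂(γ.prod γ)) ≤ 2 * (K * e) * k := by gcongr
    have h6 : (K * e) * (∫ z : EuclideanSpace ℝ (Fin k) × EuclideanSpace ℝ (Fin k), ‖z.2‖
        ∂(γ.prod γ)) ≤ (K * e) * k := by gcongr
    have h7 : 0 ≤ 2 / ρ * k * e := by positivity
    linarith

/-! ### Moments of the coordinates and concentration of norms and overlaps -/

/-- From `s² ≤ 2 exp s` at `s = Y²/t²` comes `Y⁴ ≤ 2t⁴ exp(Y²/t²)`, whose expectation is at most
`4t⁴` for an admissible `t`. -/
theorem fourth_moment_of_subGaussianNorm_le {Ω : Type*} [MeasurableSpace Ω] {μ : Measure Ω}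
    {Y : Ω → ℝ} (hY : Measurable Y) {C : ℝ≥0} (h : subGaussianNorm Y μ ≤ C) :
    Integrable (fun ω => Y ω ^ 4) μ ∧ ∫ ω, Y ω ^ 4 ∂μ ≤ 4 * ((C : ℝ) + 1) ^ 4 := by
  -- The slack `C + 1` makes the inequality strict, so an admissible `t` exists below it even if `C
  -- = 0` or the infimum is not attained.
  have hlt : subGaussianNorm Y μ < ((C + 1 : ℝ≥0) : ℝ≥0∞) :=
    h.trans_lt (by exact_mod_cast lt_add_one C)
  unfold subGaussianNorm at hlt
  simp only [iInf_lt_iff] at hlt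
  obtain ⟨t, ht, hexp, htC⟩ := hlt
  have htC' : t ≤ (C : ℝ) + 1 := by
    have := (ENNReal.ofReal_lt_coe_iff (by positivity)).1 htC
    push_cast at this
    exact this.le
  have hpt : ∀ ω, ENNReal.ofReal (Y ω ^ 4)
      ≤ ENNReal.ofReal (2 * t ^ 4) * ENNReal.ofReal (Real.exp (Y ω ^ 2 / t ^ 2)) := by
    intro ω
    rw [← ENNReal.ofReal_mul (by positivity)]
    refine ENNReal.ofReal_le_ofReal ?_
    have h0 : 0 ≤ Y ω ^ 2 / t ^ 2 := by positivity
    have := Real.quadratic_le_exp_of_nonneg h0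
    have h2 : (Y ω ^ 2 / t ^ 2) ^ 2 ≤ 2 * Real.exp (Y ω ^ 2 / t ^ 2) := by linarith
    have h3 : Y ω ^ 4 = t ^ 4 * (Y ω ^ 2 / t ^ 2) ^ 2 := by field_simp
    rw [h3]
    have : 0 < t ^ 4 := by positivity
    nlinarith
  have hl : ∫⁻ ω, ENNReal.ofReal (Y ω ^ 4) ∂μ ≤ ENNReal.ofReal (4 * t ^ 4) := by
    refine (lintegral_mono hpt).trans ?_
    rw [lintegral_const_mul _ (by fun_prop)]
    refine (mul_le_mul_right hexp _).trans ?_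
    rw [show (2 : ℝ≥0∞) = ENNReal.ofReal 2 by simp, ← ENNReal.ofReal_mul (by positivity)]
    exact ENNReal.ofReal_le_ofReal (by linarith)
  have hnn : ∀ ω, 0 ≤ Y ω ^ 4 := fun ω => by positivity
  have hm : Measurable fun ω => Y ω ^ 4 := by fun_prop
  refine ⟨⟨hm.aestronglyMeasurable, ?_⟩, ?_⟩
  · rw [hasFiniteIntegral_iff_ofReal (Filter.Eventually.of_forall hnn)]
    exact hl.trans_lt ENNReal.ofReal_lt_top
  · rw [integral_eq_lintegral_of_nonneg_ae (Filter.Eventually.of_forall hnn)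
      hm.aestronglyMeasurable]
    refine (ENNReal.toReal_mono ENNReal.ofReal_ne_top hl).trans ?_
    rw [ENNReal.toReal_ofReal (by positivity)]
    gcongr

theorem memLp_two_of_integrable_pow_four {Ω : Type*} [MeasurableSpace Ω] {μ : Measure Ω}
    [IsFiniteMeasure μ] {Y : Ω → ℝ} (hY : Measurable Y) (h : Integrable (fun ω => Y ω ^ 4) μ) :
    MemLp Y 2 μ := by
  rw [memLp_two_iff_integrable_sq hY.aestronglyMeasurable]
  refine ((integrable_const (1 : ℝ)).add h).mono' (by fun_prop) (Filter.Eventually.of_forall ?_)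
  intro ω
  rw [Real.norm_eq_abs, abs_of_nonneg (sq_nonneg _)]
  simp only [Pi.add_apply]
  nlinarith [sq_nonneg (Y ω ^ 2 - 1)]

theorem integral_sq_sum_sub_sum_integral {Ω ι : Type*} [MeasurableSpace Ω] {μ : Measure Ω}
    [IsFiniteMeasure μ] [Fintype ι] {X : ι → Ω → ℝ} (hX : ∀ i, MemLp (X i) 2 μ)
    (h : Pairwise fun i j => X i ⟂ᵢ[μ] X j) :
    ∫ ω, (∑ i, X i ω - ∑ i, ∫ ω', X i ω' ∂μ) ^ 2 ∂μ = ∑ i, variance (X i) μ := by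
  have hs := IndepFun.variance_sum (μ := μ) (X := X) (s := Finset.univ) (fun i _ => hX i)
    (fun i _ j _ hij => h hij)
  rw [← hs, variance_eq_integral (memLp_finsetSum' _ fun i _ => hX i).aemeasurable]
  simp only [Finset.sum_apply]
  rw [integral_finsetSum _ fun i _ => (hX i).integrable (by norm_num)]

/-- Independent coordinates with mean `√q`, variance `ρ - q`, and fourth moments at most `M`. -/
structure IndepCoordinates {Ω : Type*} [MeasurableSpace Ω] (μ : Measure Ω) {N : ℕ}
    (x : Ω → EuclideanSpace ℝ (Fin N)) (q ρ M : ℝ) : Prop where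
  measurable : Measurable x
  indep : iIndepFun (fun (i : Fin N) (ω : Ω) => x ω i) μ
  mean : ∀ i, ∫ ω, x ω i ∂μ = √q
  var : ∀ i, variance (fun ω => x ω i) μ = ρ - q
  integrable_four : ∀ i, Integrable (fun ω => x ω i ^ 4) μ
  moment_four : ∀ i, ∫ ω, x ω i ^ 4 ∂μ ≤ M

namespace IndepCoordinates

variable {Ω : Type*} [MeasurableSpace Ω] {μ : Measure Ω} {N : ℕ}
  {x : Ω → EuclideanSpace ℝ (Fin N)} {q ρ M : ℝ}

theorem measurable_apply (h : IndepCoordinates μ x q ρ M) (i : Fin N) :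
    Measurable fun ω => x ω i := by
  have := h.measurable
  fun_prop

theorem memLp_sq (h : IndepCoordinates μ x q ρ M) (i : Fin N) :
    MemLp (fun ω => x ω i ^ 2) 2 μ := by
  rw [memLp_two_iff_integrable_sq ((h.measurable_apply i).pow_const 2).aestronglyMeasurable]
  simpa only [← pow_mul] using h.integrable_four i

theorem memLp_norm_sq (h : IndepCoordinates μ x q ρ M) : MemLp (fun ω => ‖x ω‖ ^ 2) 2 μ := by
  simp_rw [EuclideanSpace.real_norm_sq_eq]
  exact memLp_finsetSum _ fun i _ => h.memLp_sq i

variable [IsProbabilityMeasure μ]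

theorem memLp (h : IndepCoordinates μ x q ρ M) (i : Fin N) : MemLp (fun ω => x ω i) 2 μ :=
  memLp_two_of_integrable_pow_four (h.measurable_apply i) (h.integrable_four i)

theorem integral_sq (h : IndepCoordinates μ x q ρ M) (hq : 0 ≤ q) (i : Fin N) :
    ∫ ω, x ω i ^ 2 ∂μ = ρ := by
  have := variance_eq_sub (h.memLp i)
  rw [h.var, h.mean, Real.sq_sqrt hq] at this
  have e : ∫ ω, x ω i ^ 2 ∂μ = μ[(fun ω => x ω i) ^ 2] := rfl
  linarith

theorem integral_norm_sq (h : IndepCoordinates μ x q ρ M) (hq : 0 ≤ q) :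
    ∫ ω, ‖x ω‖ ^ 2 ∂μ = N * ρ := by
  simp_rw [EuclideanSpace.real_norm_sq_eq]
  rw [integral_finsetSum _ fun i _ => (h.memLp_sq i).integrable (by norm_num)]
  simp [h.integral_sq hq]

theorem integral_apply (h : IndepCoordinates μ x q ρ M) (i : Fin N) :
    (∫ ω, x ω ∂μ) i = √q := by
  rw [eval_integral_piLp fun i => (h.memLp i).integrable (by norm_num), h.mean]

theorem norm_integral_sq (h : IndepCoordinates μ x q ρ M) (hq : 0 ≤ q) :
    ‖∫ ω, x ω ∂μ‖ ^ 2 = N * q := by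
  simp [EuclideanSpace.real_norm_sq_eq, h.integral_apply, Real.sq_sqrt hq]

theorem memLp_normalized (h : IndepCoordinates μ x q ρ M) :
    MemLp (fun ω => ‖x ω‖ ^ 2 / N - ρ) 2 μ := by
  have : MemLp (fun ω => ‖x ω‖ ^ 2 * (N : ℝ)⁻¹ - ρ) 2 μ :=
    (h.memLp_norm_sq.mul_const ((N : ℝ)⁻¹)).sub (memLp_const ρ)
  simpa only [div_eq_mul_inv] using this

/-- The squares `x_i²` are independent with mean `ρ` and variance at most their second moment, that
is the fourth moment of `x_i`; the variance of their sum is at most `N M`, then divided by `N²`. -/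
theorem integral_normalized_sq_le (h : IndepCoordinates μ x q ρ M) (hq : 0 ≤ q) (hN : 0 < N) :
    ∫ ω, (‖x ω‖ ^ 2 / N - ρ) ^ 2 ∂μ ≤ M / N := by
  have hN' : (0 : ℝ) < N := by exact_mod_cast hN
  have key := integral_sq_sum_sub_sum_integral (X := fun i ω => x ω i ^ 2) h.memLp_sq
    (fun i j hij => (h.indep.indepFun hij).comp (φ := fun y => y ^ 2) (ψ := fun y => y ^ 2)
      (by fun_prop) (by fun_prop))
  have hv : ∀ i, variance (fun ω => x ω i ^ 2) μ ≤ M := fun i => by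
    refine (variance_le_expectation_sq
      ((h.measurable_apply i).pow_const 2).aestronglyMeasurable).trans ?_
    refine le_trans (le_of_eq ?_) (h.moment_four i)
    refine integral_congr_ae (Filter.Eventually.of_forall fun ω => ?_)
    simp only [Pi.pow_apply]; ring
  have e : ∀ ω, (‖x ω‖ ^ 2 / N - ρ) ^ 2
      = (∑ i, x ω i ^ 2 - ∑ i, ∫ ω', x ω' i ^ 2 ∂μ) ^ 2 * ((N : ℝ) ^ 2)⁻¹ := by
    intro ω
    simp only [h.integral_sq hq, ← EuclideanSpace.real_norm_sq_eq, Finset.sum_const,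
      Finset.card_univ, Fintype.card_fin, nsmul_eq_mul]
    field_simp
  simp_rw [e]
  rw [integral_mul_const, key]
  calc (∑ i, variance (fun ω => x ω i ^ 2) μ) * ((N : ℝ) ^ 2)⁻¹
      ≤ (∑ _i : Fin N, M) * ((N : ℝ) ^ 2)⁻¹ := by
        gcongr with i _; exact hv i
    _ = M / N := by simp; field_simp

open scoped RealInnerProductSpace in
theorem memLp_inner (h : IndepCoordinates μ x q ρ M) (v : EuclideanSpace ℝ (Fin N)) :
    MemLp (fun ω => ⟪v, x ω⟫) 2 μ := by
  simp only [PiLp.inner_apply, RCLike.inner_apply, conj_trivial]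
  exact memLp_finsetSum _ fun i _ => (h.memLp i).mul_const _

open scoped RealInnerProductSpace in
theorem integral_inner_sub_sq (h : IndepCoordinates μ x q ρ M) (v : EuclideanSpace ℝ (Fin N)) :
    ∫ ω, (⟪v, x ω⟫ - ⟪v, ∫ ω', x ω' ∂μ⟫) ^ 2 ∂μ = (ρ - q) * ‖v‖ ^ 2 := by
  have key := integral_sq_sum_sub_sum_integral (X := fun i ω => v i * x ω i)
    (fun i => (h.memLp i).const_mul _)
    (fun i j hij => (h.indep.indepFun hij).comp (φ := fun y => v i * y) (ψ := fun y => v j * y)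
      (by fun_prop) (by fun_prop))
  have e : ∀ ω, (⟪v, x ω⟫ - ⟪v, ∫ ω', x ω' ∂μ⟫)
      = ∑ i, v i * x ω i - ∑ i, ∫ ω', v i * x ω' i ∂μ := by
    intro ω
    simp only [PiLp.inner_apply, RCLike.inner_apply, conj_trivial, integral_const_mul, h.mean,
      h.integral_apply, mul_comm]
  simp_rw [e]
  rw [key]
  simp only [variance_const_mul, h.var, EuclideanSpace.real_norm_sq_eq, Finset.mul_sum, mul_comm]

open scoped RealInnerProductSpace in
theorem memLp_inner_mean (h : IndepCoordinates μ x q ρ M) :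
    MemLp (fun ω => ⟪x ω, ∫ ω', x ω' ∂μ⟫ / N - q) 2 μ := by
  have : MemLp (fun ω => ⟪∫ ω', x ω' ∂μ, x ω⟫ * (N : ℝ)⁻¹ - q) 2 μ :=
    ((h.memLp_inner (∫ ω', x ω' ∂μ)).mul_const ((N : ℝ)⁻¹)).sub (memLp_const q)
  simpa only [div_eq_mul_inv, real_inner_comm] using this

open scoped RealInnerProductSpace in
theorem integral_inner_mean_sq (h : IndepCoordinates μ x q ρ M) (hq : 0 ≤ q) (hN : 0 < N) :
    ∫ ω, (⟪x ω, ∫ ω', x ω' ∂μ⟫ / N - q) ^ 2 ∂μ = (ρ - q) * q / N := by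
  have hN' : (0 : ℝ) < N := by exact_mod_cast hN
  have e : ∀ ω, (⟪x ω, ∫ ω', x ω' ∂μ⟫ / N - q) ^ 2
      = (⟪∫ ω', x ω' ∂μ, x ω⟫ - ⟪∫ ω', x ω' ∂μ, ∫ ω', x ω' ∂μ⟫) ^ 2 * ((N : ℝ) ^ 2)⁻¹ := by
    intro ω
    rw [real_inner_self_eq_norm_sq, h.norm_integral_sq hq, real_inner_comm]
    field_simp
  simp_rw [e]
  rw [integral_mul_const, h.integral_inner_sub_sq, h.norm_integral_sq hq]
  field_simp

open scoped RealInnerProductSpace in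
theorem integrable_inner_prod_sq (h : IndepCoordinates μ x q ρ M) :
    Integrable (fun z : Ω × Ω => (⟪x z.1, x z.2⟫ / N - q) ^ 2) (μ.prod μ) := by
  have hx := h.measurable
  have hI : Integrable (fun ω => ‖x ω‖ ^ 2) μ := h.memLp_norm_sq.integrable (by norm_num)
  refine (((hI.mul_prod hI).const_mul (2 / (N : ℝ) ^ 2)).add
    (integrable_const (2 * q ^ 2))).mono' (by fun_prop) (Filter.Eventually.of_forall fun z => ?_)
  rw [Real.norm_eq_abs, abs_of_nonneg (sq_nonneg _)]
  simp only [Pi.add_apply]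
  have h1 : (⟪x z.1, x z.2⟫ / N) ^ 2 ≤ (‖x z.1‖ ^ 2 * ‖x z.2‖ ^ 2) / N ^ 2 := by
    rw [div_pow, ← mul_pow]
    refine div_le_div_of_nonneg_right ?_ (sq_nonneg _)
    exact sq_le_sq' (neg_le_of_abs_le (abs_real_inner_le_norm _ _)) (real_inner_le_norm _ _)
  have h2 : 2 / (N : ℝ) ^ 2 * (‖x z.1‖ ^ 2 * ‖x z.2‖ ^ 2)
      = 2 * ((‖x z.1‖ ^ 2 * ‖x z.2‖ ^ 2) / N ^ 2) := by ring
  rw [h2]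
  nlinarith [sq_nonneg (⟪x z.1, x z.2⟫ / N + q)]

-- With the first replica frozen, `⟪x, x'⟫/N - q` splits into the fluctuation `⟪x, x' - m⟫/N` and
-- the error `⟪x, m⟫/N - q`. By `(s + t)² ≤ 2s² + 2t²` these contribute `2(ρ-q)ρ/N` and `2(ρ-q)q/N`
-- after averaging.
open scoped RealInnerProductSpace in
theorem integral_inner_prod_sq_le (h : IndepCoordinates μ x q ρ M) (hq : 0 ≤ q) (hN : 0 < N) :
    ∫ z : Ω × Ω, (⟪x z.1, x z.2⟫ / N - q) ^ 2 ∂(μ.prod μ) ≤ 2 * (ρ - q) * (ρ + q) / N := by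
  have hN' : (0 : ℝ) < N := by exact_mod_cast hN
  have hx := h.measurable
  rw [integral_prod _ h.integrable_inner_prod_sq]
  have hI : Integrable (fun ω => ‖x ω‖ ^ 2) μ := h.memLp_norm_sq.integrable (by norm_num)
  have hin : ∀ ω, ∫ ω', (⟪x ω, x ω'⟫ / N - q) ^ 2 ∂μ
      ≤ 2 * (ρ - q) / N ^ 2 * ‖x ω‖ ^ 2 + 2 * (⟪x ω, ∫ ω', x ω' ∂μ⟫ / N - q) ^ 2 := by
    intro ω
    have i1 : Integrable (fun ω' => (⟪x ω, x ω'⟫ - ⟪x ω, ∫ ω', x ω' ∂μ⟫) ^ 2) μ :=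
      ((h.memLp_inner (x ω)).sub (memLp_const _)).integrable_sq
    calc ∫ ω', (⟪x ω, x ω'⟫ / N - q) ^ 2 ∂μ
        ≤ ∫ ω', (2 / N ^ 2 * (⟪x ω, x ω'⟫ - ⟪x ω, ∫ ω', x ω' ∂μ⟫) ^ 2
            + 2 * (⟪x ω, ∫ ω', x ω' ∂μ⟫ / N - q) ^ 2) ∂μ := by
          refine integral_mono_of_nonneg (Filter.Eventually.of_forall fun _ => sq_nonneg _)
            ((i1.const_mul _).add (integrable_const _)) (Filter.Eventually.of_forall fun ω' => ?_)
          have e : 2 / (N : ℝ) ^ 2 * (⟪x ω, x ω'⟫ - ⟪x ω, ∫ ω', x ω' ∂μ⟫) ^ 2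
              = 2 * (⟪x ω, x ω'⟫ / N - ⟪x ω, ∫ ω', x ω' ∂μ⟫ / N) ^ 2 := by
            field_simp
          simp only
          rw [e]
          nlinarith [sq_nonneg ((⟪x ω, x ω'⟫ / N - ⟪x ω, ∫ ω', x ω' ∂μ⟫ / N)
            - (⟪x ω, ∫ ω', x ω' ∂μ⟫ / N - q))]
      _ = _ := by
          rw [integral_add (i1.const_mul _) (integrable_const _), integral_const_mul,
            h.integral_inner_sub_sq]
          simp; ring
  have hI2 := h.memLp_inner_mean.integrable_sq
  refine (integral_mono h.integrable_inner_prod_sq.integral_prod_left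
    ((hI.const_mul _).add (hI2.const_mul _)) hin).trans (le_of_eq ?_)
  rw [integral_add' (hI.const_mul _) (hI2.const_mul _), integral_const_mul, integral_const_mul,
    h.integral_norm_sq hq, h.integral_inner_mean_sq hq hN]
  field_simp

end IndepCoordinates

/-! ### Correlations of averaged projections by replicas -/

/-- The average of `g` over the Gaussian vector `Θᵀ h + r ξ`, with `ξ` standard Gaussian. -/
noncomputable def smoothedProjection {N k : ℕ} (g : EuclideanSpace ℝ (Fin k) → ℝ) (r : ℝ)
    (Θ : Fin N → Fin k → ℝ) (h : EuclideanSpace ℝ (Fin N)) : ℝ :=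
  ∫ ξ, g (projectVec Θ h + r • ξ) ∂(stdGaussian (EuclideanSpace ℝ (Fin k)))

section smoothedProjection

variable {N k : ℕ} {g : EuclideanSpace ℝ (Fin k) → ℝ}

theorem smoothedProjection_zero (Θ : Fin N → Fin k → ℝ) (h : EuclideanSpace ℝ (Fin N)) :
    smoothedProjection g 0 Θ h = g (projectVec Θ h) := by
  simp [smoothedProjection]

theorem abs_smoothedProjection_le_one (hg1 : ∀ y, |g y| ≤ 1) (r : ℝ) (Θ : Fin N → Fin k → ℝ)
    (h : EuclideanSpace ℝ (Fin N)) : |smoothedProjection g r Θ h| ≤ 1 :=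
  abs_integral_le_one fun _ => hg1 _

theorem Measurable.smoothedProjection {α : Type*} [MeasurableSpace α] (hg : Measurable g) (r : ℝ)
    {f : α → Fin N → Fin k → ℝ} {h : α → EuclideanSpace ℝ (Fin N)} (hf : Measurable f)
    (hh : Measurable h) : Measurable fun a => _root_.smoothedProjection g r (f a) (h a) := by
  have hm : Measurable fun w : α × EuclideanSpace ℝ (Fin k) =>
      g (_root_.projectVec (f w.1) (h w.1) + r • w.2) :=
    hg.comp (((hf.comp measurable_fst).projectVec (hh.comp measurable_fst)).add (by fun_prop))
  exact hm.stronglyMeasurable.integral_prod_right'.measurable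

-- The two smoothings use independent copies of `ξ`, so the product of averages is an average over
-- the pair, whose joint law with `Θ` is the Cholesky one.
open scoped RealInnerProductSpace in
theorem integral_smoothedProjection_mul (hg : Measurable g) (hg1 : ∀ y, |g y| ≤ 1) (r r' : ℝ)
    (h h' : EuclideanSpace ℝ (Fin N)) :
    ∫ Θ, smoothedProjection g r Θ h * smoothedProjection g r' Θ h' ∂(gaussianProjectionLaw N k)
      = ∫ z, g (choleskyPair (‖h‖ ^ 2 / N + r ^ 2) (⟪h, h'⟫ / N) (‖h'‖ ^ 2 / N + r' ^ 2) z).1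
          * g (choleskyPair (‖h‖ ^ 2 / N + r ^ 2) (⟪h, h'⟫ / N) (‖h'‖ ^ 2 / N + r' ^ 2) z).2
          ∂((stdGaussian (EuclideanSpace ℝ (Fin k))).prod
            (stdGaussian (EuclideanSpace ℝ (Fin k)))) := by
  have hgg : Measurable fun y : EuclideanSpace ℝ (Fin k) × EuclideanSpace ℝ (Fin k) =>
      g y.1 * g y.2 := (hg.comp measurable_fst).mul (hg.comp measurable_snd)
  have hm : Measurable (fun w : (Fin N → Fin k → ℝ) × EuclideanSpace ℝ (Fin k) ×
      EuclideanSpace ℝ (Fin k) =>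
      (projectVec w.1 h + r • w.2.1, projectVec w.1 h' + r' • w.2.2)) := by
    have := (measurable_fst (α := Fin N → Fin k → ℝ) (β := EuclideanSpace ℝ (Fin k) ×
      EuclideanSpace ℝ (Fin k))).projectVec (measurable_const (a := h))
    have := (measurable_fst (α := Fin N → Fin k → ℝ) (β := EuclideanSpace ℝ (Fin k) ×
      EuclideanSpace ℝ (Fin k))).projectVec (measurable_const (a := h'))
    fun_prop
  have hint : Integrable (fun w : (Fin N → Fin k → ℝ) × EuclideanSpace ℝ (Fin k) ×
      EuclideanSpace ℝ (Fin k) => g (projectVec w.1 h + r • w.2.1) *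
        g (projectVec w.1 h' + r' • w.2.2)) ((gaussianProjectionLaw N k).prod
        ((stdGaussian (EuclideanSpace ℝ (Fin k))).prod (stdGaussian (EuclideanSpace ℝ (Fin k))))) :=
    integrable_of_abs_le_one (hgg.comp hm) fun _ => abs_mul_le_one_of_abs_le_one (hg1 _) (hg1 _)
  rw [← integral_map (measurable_choleskyPair _ _ _).aemeasurable
      (f := fun y => g y.1 * g y.2) hgg.aestronglyMeasurable,
    ← map_projectVec_pair_eq_map_choleskyPair, integral_map hm.aemeasurable
      hgg.aestronglyMeasurable, integral_prod _ hint]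
  refine integral_congr_ae (Filter.Eventually.of_forall fun Θ => ?_)
  exact (integral_prod_mul (fun ξ => g (projectVec Θ h + r • ξ))
    (fun ξ => g (projectVec Θ h' + r' • ξ))).symm

end smoothedProjection

theorem integral_integral_mul_integral {Ω T : Type*} [MeasurableSpace Ω] [MeasurableSpace T]
    {μ : Measure Ω} [IsProbabilityMeasure μ] {P : Measure T} [IsProbabilityMeasure P]
    {F F' : T × Ω → ℝ} (hF : Measurable F) (hF' : Measurable F')
    (hF1 : ∀ z, |F z| ≤ 1) (hF1' : ∀ z, |F' z| ≤ 1) :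
    ∫ t, (∫ ω, F (t, ω) ∂μ) * (∫ ω, F' (t, ω) ∂μ) ∂P
      = ∫ z : Ω × Ω, ∫ t, F (t, z.1) * F' (t, z.2) ∂P ∂(μ.prod μ) := by
  simp_rw [← integral_prod_mul]
  refine integral_integral_swap (f := fun t (z : Ω × Ω) => F (t, z.1) * F' (t, z.2)) ?_
  exact integrable_of_abs_le_one (by unfold Function.uncurry; fun_prop)
    fun _ => abs_mul_le_one_of_abs_le_one (hF1 _) (hF1' _)

/-- This is `(s|t| - 1)² ≥ 0`. With `s = √N` it turns second moments of order `1/N` into first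
moments of order `1/√N`, in place of Cauchy–Schwarz. -/
theorem abs_le_mul_sq_add_inv {s : ℝ} (hs : 0 < s) (t : ℝ) :
    |t| ≤ s / 2 * t ^ 2 + 1 / (2 * s) := by
  have : s / 2 * t ^ 2 + 1 / (2 * s) - |t| = (s * |t| - 1) ^ 2 / (2 * s) := by
    rw [← sq_abs t]; field_simp; ring
  have h : 0 ≤ (s * |t| - 1) ^ 2 / (2 * s) := by positivity
  linarith

theorem integral_mul_sq_add_inv_le {α : Type*} [MeasurableSpace α] {μ : Measure α}
    [IsProbabilityMeasure μ] {f : α → ℝ} {N : ℕ} (hN : 0 < N) {M : ℝ}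
    (hf : Integrable (fun a => f a ^ 2) μ) (hM : ∫ a, f a ^ 2 ∂μ ≤ M / N) :
    Integrable (fun a => √N / 2 * f a ^ 2 + 1 / (2 * √N)) μ ∧
      ∫ a, (√N / 2 * f a ^ 2 + 1 / (2 * √N)) ∂μ ≤ (M + 1) / (2 * √N) := by
  have hN' : (0 : ℝ) < N := by exact_mod_cast hN
  have hs : 0 < √(N : ℝ) := Real.sqrt_pos.2 hN'
  refine ⟨(hf.const_mul _).add (integrable_const _), ?_⟩
  rw [integral_add (hf.const_mul _) (integrable_const _), integral_const_mul]
  simp only [integral_const, probReal_univ, one_smul]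
  have : √(N : ℝ) / 2 * (M / N) + 1 / (2 * √N) = (M + 1) / (2 * √N) := by
    have h2 : (N : ℝ) = √N * √N := (Real.mul_self_sqrt hN'.le).symm
    rw [show M / (N : ℝ) = M / (√N * √N) by rw [← h2]]
    field_simp
  rw [← this]
  gcongr

open scoped RealInnerProductSpace in
/-- The correlation of two averaged smoothed projections is close to its value for the limiting
covariance, when the normalized Gram matrix concentrates. -/
theorem abs_correlation_sub_le {q ρ : ℝ} (hq : 0 < q) (hqρ : q < ρ) :
    ∃ K : ℝ, 0 < K ∧ ∀ (N k : ℕ), 0 < N → 1 ≤ k → ∀ g : EuclideanSpace ℝ (Fin k) → ℝ,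
      LipschitzWith 1 g → (∀ y, |g y| ≤ 1) →
      ∀ (Ω : Type*) [MeasurableSpace Ω] (μ : Measure Ω) [IsProbabilityMeasure μ]
        (h h' : Ω → EuclideanSpace ℝ (Fin N)) (r r' M : ℝ), Measurable h → Measurable h' →
        Integrable (fun ω => (‖h ω‖ ^ 2 / N + r ^ 2 - ρ) ^ 2) μ →
        ∫ ω, (‖h ω‖ ^ 2 / N + r ^ 2 - ρ) ^ 2 ∂μ ≤ M / N →
        Integrable (fun ω => (‖h' ω‖ ^ 2 / N + r' ^ 2 - ρ) ^ 2) μ →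
        ∫ ω, (‖h' ω‖ ^ 2 / N + r' ^ 2 - ρ) ^ 2 ∂μ ≤ M / N →
        Integrable (fun z : Ω × Ω => (⟪h z.1, h' z.2⟫ / N - q) ^ 2) (μ.prod μ) →
        ∫ z : Ω × Ω, (⟪h z.1, h' z.2⟫ / N - q) ^ 2 ∂(μ.prod μ) ≤ M / N →
        |(∫ Θ, (∫ ω, smoothedProjection g r Θ (h ω) ∂μ)
            * (∫ ω, smoothedProjection g r' Θ (h' ω) ∂μ) ∂(gaussianProjectionLaw N k))
          - ∫ z, g (choleskyPair ρ q ρ z).1 * g (choleskyPair ρ q ρ z).2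
            ∂((stdGaussian (EuclideanSpace ℝ (Fin k))).prod
              (stdGaussian (EuclideanSpace ℝ (Fin k))))|
          ≤ K * (M + 1) * k / √N := by
  obtain ⟨K, hK, hKL⟩ := abs_integral_choleskyPair_sub_le hq hqρ
  -- Three deviations, for `a`, `b` and `c`, each contribute `(M + 1) / (2√N)`.
  refine ⟨K * (3 / 2), by positivity, ?_⟩
  intro N k hN hk g hgL hg1 Ω _ μ _ h h' r r' M hh hh' ha ha2 hb hb2 hc hc2
  have hgm : Measurable g := hgL.continuous.measurable
  have hN' : (0 : ℝ) < N := by exact_mod_cast hN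
  have hs : 0 < √(N : ℝ) := Real.sqrt_pos.2 hN'
  have hF : Measurable fun z : (Fin N → Fin k → ℝ) × Ω => smoothedProjection g r z.1 (h z.2) :=
    hgm.smoothedProjection r measurable_fst (hh.comp measurable_snd)
  have hF' : Measurable fun z : (Fin N → Fin k → ℝ) × Ω => smoothedProjection g r' z.1 (h' z.2) :=
    hgm.smoothedProjection r' measurable_fst (hh'.comp measurable_snd)
  rw [integral_integral_mul_integral hF hF'
    (fun _ => abs_smoothedProjection_le_one hg1 _ _ _)
    (fun _ => abs_smoothedProjection_le_one hg1 _ _ _)]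
  set G₀ := ∫ z, g (choleskyPair ρ q ρ z).1 * g (choleskyPair ρ q ρ z).2
            ∂((stdGaussian (EuclideanSpace ℝ (Fin k))).prod
              (stdGaussian (EuclideanSpace ℝ (Fin k))))
  obtain ⟨ia, ba⟩ := integral_mul_sq_add_inv_le (μ := μ.prod μ)
    (f := fun z : Ω × Ω => ‖h z.1‖ ^ 2 / N + r ^ 2 - ρ) hN (ha.comp_fst μ)
    (by rw [integral_fun_fst (μ := μ) (ν := μ) (fun ω => (‖h ω‖ ^ 2 / N + r ^ 2 - ρ) ^ 2)]
        simpa using ha2)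
  obtain ⟨ib, bb⟩ := integral_mul_sq_add_inv_le (μ := μ.prod μ)
    (f := fun z : Ω × Ω => ‖h' z.2‖ ^ 2 / N + r' ^ 2 - ρ) hN (hb.comp_snd μ)
    (by rw [integral_fun_snd (μ := μ) (ν := μ) (fun ω => (‖h' ω‖ ^ 2 / N + r' ^ 2 - ρ) ^ 2)]
        simpa using hb2)
  obtain ⟨ic, bc⟩ := integral_mul_sq_add_inv_le hN hc hc2
  have hmeas : Measurable fun z : Ω × Ω => ∫ Θ, smoothedProjection g r Θ (h z.1)
      * smoothedProjection g r' Θ (h' z.2) ∂(gaussianProjectionLaw N k) := by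
    have : Measurable fun w : (Ω × Ω) × (Fin N → Fin k → ℝ) =>
        smoothedProjection g r w.2 (h w.1.1) * smoothedProjection g r' w.2 (h' w.1.2) :=
      (hgm.smoothedProjection r measurable_snd (hh.comp measurable_fst.fst)).mul
        (hgm.smoothedProjection r' measurable_snd (hh'.comp measurable_fst.snd))
    exact this.stronglyMeasurable.integral_prod_right'.measurable
  have hint : Integrable (fun z : Ω × Ω => ∫ Θ, smoothedProjection g r Θ (h z.1)
      * smoothedProjection g r' Θ (h' z.2) ∂(gaussianProjectionLaw N k)) (μ.prod μ) :=
    integrable_of_abs_le_one hmeas fun z => abs_integral_le_one fun Θ =>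
      abs_mul_le_one_of_abs_le_one (abs_smoothedProjection_le_one hg1 _ _ _)
        (abs_smoothedProjection_le_one hg1 _ _ _)
  have hG : G₀ = ∫ _z : Ω × Ω, G₀ ∂(μ.prod μ) := by simp
  rw [hG, ← integral_sub hint (integrable_const _)]
  refine abs_integral_le_integral_abs.trans ?_
  have hpt : ∀ z : Ω × Ω, |(∫ Θ, smoothedProjection g r Θ (h z.1)
      * smoothedProjection g r' Θ (h' z.2) ∂(gaussianProjectionLaw N k)) - G₀|
      ≤ K * k * ((√N / 2 * (‖h z.1‖ ^ 2 / N + r ^ 2 - ρ) ^ 2 + 1 / (2 * √N))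
        + (√N / 2 * (‖h' z.2‖ ^ 2 / N + r' ^ 2 - ρ) ^ 2 + 1 / (2 * √N))
        + (√N / 2 * (⟪h z.1, h' z.2⟫ / N - q) ^ 2 + 1 / (2 * √N))) := by
    intro z
    rw [integral_smoothedProjection_mul hgm hg1]
    refine (hKL k hk g hgL hg1 _ _ _ (by positivity) (by positivity)
      (sq_inner_div_le _ _ _ _)).trans ?_
    gcongr <;> exact abs_le_mul_sq_add_inv hs _
  refine (integral_mono (hint.sub (integrable_const _)).abs
    (((ia.add ib).add ic).const_mul _) hpt).trans ?_
  rw [integral_const_mul, integral_add' (ia.add ib) ic, integral_add' ia ib]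
  calc K * k * _ ≤ K * k * ((M + 1) / (2 * √N) + (M + 1) / (2 * √N) + (M + 1) / (2 * √N)) := by
        gcongr
    _ = K * (3 / 2) * (M + 1) * k / √N := by ring

theorem pow_le_four_pow_mul {t : ℝ} (h0 : 0 ≤ t) (h4 : t ≤ 4) {p : ℕ} (hp : 1 ≤ p) :
    t ^ p ≤ 4 ^ p * t := by
  obtain ⟨m, rfl⟩ := Nat.exists_eq_add_of_le' hp
  rw [pow_succ, pow_succ]
  have h1 : t ^ m ≤ 4 ^ m := by gcongr
  have h2 : t ^ m * t ≤ 4 ^ m * t := by gcongr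
  have h3 : 0 ≤ (4 : ℝ) ^ m * t := by positivity
  linarith

/-! ### Comparison of the two averages -/

theorem mainTheorem7 (p : ℕ) (hp : 1 ≤ p) (q ρ : ℝ) (hq : 0 < q) (hqρ : q < ρ) (C : ℝ≥0) :
    ∃ K : ℝ, 0 < K ∧
      ∀ (N k : ℕ), 1 ≤ k → k < N →
      ∀ (Ω : Type*) [MeasurableSpace Ω] (μ : Measure Ω) [IsProbabilityMeasure μ]
        (x : Ω → EuclideanSpace ℝ (Fin N)), Measurable x →
        iIndepFun (fun (i : Fin N) (ω : Ω) => x ω i) μ →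
        (∀ i, ∫ ω, x ω i ∂μ = Real.sqrt q) →
        (∀ i, variance (fun ω => x ω i) μ = ρ - q) →
        (⨆ i, subGaussianNorm (fun ω => x ω i) μ) ≤ (C : ℝ≥0∞) →
        ∀ g : EuclideanSpace ℝ (Fin k) → ℝ, LipschitzWith 1 g → (∀ y, |g y| ≤ 1) →
          ∫ Θ, ((∫ ω, g (projectVec Θ (x ω)) ∂μ)
              - ∫ ξ, g (projectVec Θ (∫ ω, x ω ∂μ) + Real.sqrt (ρ - q) • ξ)
                  ∂(stdGaussian (EuclideanSpace ℝ (Fin k)))) ^ (2 * p)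
            ∂(gaussianProjectionLaw N k)
          ≤ K * k / Real.sqrt N := by
  obtain ⟨K, hK, hKL⟩ := abs_correlation_sub_le hq hqρ
  -- The sum of the bounds for `‖x‖²/N`, `⟪x, x'⟫/N` and `⟪x, m⟫/N`, so that one constant serves all
  -- three correlations.
  set M : ℝ := 4 * ((C : ℝ) + 1) ^ 4 + 2 * (ρ - q) * (ρ + q) + (ρ - q) * q with hM
  have hρq : 0 < ρ - q := sub_pos.2 hqρ
  have hM1 : 0 ≤ 4 * ((C : ℝ) + 1) ^ 4 := by positivity
  have hM2 : 0 ≤ 2 * (ρ - q) * (ρ + q) := mul_nonneg (by linarith) (by linarith)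
  have hM3 : 0 ≤ (ρ - q) * q := by positivity
  have hM0 : 0 ≤ M := by linarith
  -- `4 ^ p` reduces the power `2p` to `2`; the inner `4 = 1 + 2 + 1` counts the correlation errors
  -- in the expanded square.
  refine ⟨4 ^ p * (4 * (K * (M + 1))), by positivity, ?_⟩
  intro N k hk hkN Ω _ μ _ x hx hind hmean hvar hsub g hgL hg1
  have hN : 0 < N := by omega
  have hN' : (0 : ℝ) < N := by exact_mod_cast hN
  have h4 := fun i => fourth_moment_of_subGaussianNorm_le (μ := μ) (Y := fun ω => x ω i)
    (by fun_prop) ((le_iSup (fun i => subGaussianNorm (fun ω => x ω i) μ) i).trans hsub)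
  have hX : IndepCoordinates μ x q ρ (4 * ((C : ℝ) + 1) ^ 4) :=
    ⟨hx, hind, hmean, hvar, fun i => (h4 i).1, fun i => (h4 i).2⟩
  have hgm : Measurable g := hgL.continuous.measurable
  set m := ∫ ω, x ω ∂μ with hm
  have hm2 : ‖m‖ ^ 2 = N * q := hX.norm_integral_sq hq.le
  have hσ : √(ρ - q) ^ 2 = ρ - q := Real.sq_sqrt hρq.le
  have hmm : ‖m‖ ^ 2 / N + √(ρ - q) ^ 2 - ρ = 0 := by
    rw [hm2, hσ]; field_simp; ring
  have hmq : inner ℝ m m / N - q = 0 := by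
    rw [real_inner_self_eq_norm_sq, hm2]; field_simp; ring
  have hMN : 0 ≤ M / N := by positivity
  have a1 : Integrable (fun ω => (‖x ω‖ ^ 2 / N + (0 : ℝ) ^ 2 - ρ) ^ 2) μ := by
    simpa using hX.memLp_normalized.integrable_sq
  have a2 : ∫ ω, (‖x ω‖ ^ 2 / N + (0 : ℝ) ^ 2 - ρ) ^ 2 ∂μ ≤ M / N := by
    have := hX.integral_normalized_sq_le hq.le hN
    have h2 : 4 * ((C : ℝ) + 1) ^ 4 / N ≤ M / N := by gcongr; linarith
    simpa using this.trans h2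
  have b1 : Integrable (fun _ : Ω => (‖m‖ ^ 2 / N + √(ρ - q) ^ 2 - ρ) ^ 2) μ := integrable_const _
  have b2 : ∫ _ : Ω, (‖m‖ ^ 2 / N + √(ρ - q) ^ 2 - ρ) ^ 2 ∂μ ≤ M / N := by
    simpa [hmm] using hMN
  have cxx := (hX.integral_inner_prod_sq_le hq.le hN).trans
    (div_le_div_of_nonneg_right (by linarith : 2 * (ρ - q) * (ρ + q) ≤ M) hN'.le)
  have cxm := (hX.integral_inner_mean_sq hq.le hN).le.trans
    (div_le_div_of_nonneg_right (by linarith : (ρ - q) * q ≤ M) hN'.le)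
  -- `R1`, `R2`, `R3` treat `𝔼A²`, `𝔼AB`, `𝔼B²`. Radius `0` encodes the unsmoothed average `A`; the
  -- constant field `m` with radius `√(ρ-q)` encodes `B`.
  have R1 := hKL N k hN hk g hgL hg1 Ω μ x x 0 0 M hx hx a1 a2 a1 a2
    hX.integrable_inner_prod_sq cxx
  have R2 := hKL N k hN hk g hgL hg1 Ω μ x (fun _ => m) 0 (√(ρ - q)) M hx measurable_const
    a1 a2 b1 b2 (hX.memLp_inner_mean.integrable_sq.comp_fst μ)
    (by rw [integral_fun_fst (μ := μ) (ν := μ) (fun ω => (inner ℝ (x ω) m / N - q) ^ 2)]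
        simpa using cxm)
  have R3 := hKL N k hN hk g hgL hg1 Ω μ (fun _ => m) (fun _ => m) (√(ρ - q)) (√(ρ - q)) M
    measurable_const measurable_const b1 b2 b1 b2 (integrable_const _)
    (by simp only [hmq]; simpa using hMN)
  simp only [smoothedProjection_zero, integral_const, probReal_univ, one_smul] at R1 R2 R3
  set A : (Fin N → Fin k → ℝ) → ℝ := fun Θ => ∫ ω, g (projectVec Θ (x ω)) ∂μ with hA
  set B : (Fin N → Fin k → ℝ) → ℝ := fun Θ => smoothedProjection g (√(ρ - q)) Θ m with hB
  have hA1 : ∀ Θ, |A Θ| ≤ 1 := fun Θ => abs_integral_le_one fun _ => hg1 _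
  have hB1 : ∀ Θ, |B Θ| ≤ 1 := fun Θ => abs_smoothedProjection_le_one hg1 _ _ _
  have hAm : Measurable A := by
    have : Measurable fun z : (Fin N → Fin k → ℝ) × Ω => g (projectVec z.1 (x z.2)) :=
      hgm.comp (Measurable.projectVec measurable_fst (hx.comp measurable_snd))
    exact this.stronglyMeasurable.integral_prod_right'.measurable
  have hBm : Measurable B :=
    hgm.smoothedProjection _ measurable_id measurable_const
  have iAA : Integrable (fun Θ => A Θ * A Θ) (gaussianProjectionLaw N k) :=
    integrable_of_abs_le_one (hAm.mul hAm) fun Θ => abs_mul_le_one_of_abs_le_one (hA1 Θ) (hA1 Θ)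
  have iAB : Integrable (fun Θ => A Θ * B Θ) (gaussianProjectionLaw N k) :=
    integrable_of_abs_le_one (hAm.mul hBm) fun Θ => abs_mul_le_one_of_abs_le_one (hA1 Θ) (hB1 Θ)
  have iBB : Integrable (fun Θ => B Θ * B Θ) (gaussianProjectionLaw N k) :=
    integrable_of_abs_le_one (hBm.mul hBm) fun Θ => abs_mul_le_one_of_abs_le_one (hB1 Θ) (hB1 Θ)
  have iD := ((iAA.sub (iAB.const_mul 2)).add iBB).const_mul (4 ^ p)
  change ∫ Θ, (A Θ - B Θ) ^ (2 * p) ∂(gaussianProjectionLaw N k) ≤ _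
  have hpt : ∀ Θ, (A Θ - B Θ) ^ (2 * p)
      ≤ 4 ^ p * (A Θ * A Θ - 2 * (A Θ * B Θ) + B Θ * B Θ) := by
    intro Θ
    have e : A Θ * A Θ - 2 * (A Θ * B Θ) + B Θ * B Θ = (A Θ - B Θ) ^ 2 := by ring
    rw [e, pow_mul]
    refine pow_le_four_pow_mul (sq_nonneg _) ?_ hp
    have := (abs_sub (A Θ) (B Θ)).trans (add_le_add (hA1 Θ) (hB1 Θ))
    nlinarith [sq_abs (A Θ - B Θ), abs_nonneg (A Θ - B Θ)]
  refine (integral_mono_of_nonneg (Filter.Eventually.of_forall fun Θ =>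
    (even_two_mul p).pow_nonneg _) iD (Filter.Eventually.of_forall hpt)).trans ?_
  rw [integral_const_mul, integral_add' (iAA.sub (iAB.const_mul 2)) iBB,
    integral_sub' iAA (iAB.const_mul 2), integral_const_mul]
  have r1 := abs_le.1 R1
  have r2 := abs_le.1 R2
  have r3 := abs_le.1 R3
  have hfin : 4 ^ p * (4 * (K * (M + 1))) * k / √(N : ℝ)
      = 4 ^ p * (4 * (K * (M + 1) * k / √N)) := by ring
  rw [hfin]
  gcongr
  -- The limiting correlation drops out; upper bounds are used for the two squares and the lower
  -- bound for the cross term.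
  linarith [r1.2, r2.1, r3.2]
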